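/- **Setting.** Let $V$ be a finite vocabulary. A language model generates a random text $s^{(0)},s^{(1)},\dots$ token by token on a probability space. At step $t$ a bit $m^{(t)}\in\{0,1\}$ is to be embedded and the vocabulary is split into a green list $G^{(t)}$ and a red list $R^{(t)}=V\setminus G^{(t)}$; the *required* list is $G^{(t)}$ if $m^{(t)}=1$ and $R^{(t)}$ if $m^{(t)}=0$. The model computes logits $l^{(t)}\in\mathbb R^V$ from the prompt and the tokens $s^{(0)},\dots,s^{(t-1)}$, a bias $\delta\in\mathbb R$ is added to the logits of the required tokens, and, given the earlier tokens, $G^{(t)}$ and $m^{(t)}$, the token $s^{(t)}$ is drawn from the softmax of the biased logits. Let $P_G'^{(t)}$ (if $m^{(t)}=1$), respectively $P_R'^{(t)}$ (if $m^{(t)}=0$), be the probability that the biased softmax gives to the required list, let $P'^{(t)}$ be $P_G'^{(t)}$ on $\{m^{(t)}=1\}$ and $P_R'^{(t)}$ on $\{m^{(t)}=0\}$, and let $\mathbb E[P'^{(t)}]$ be its expectation. (If the logits and lists of step $t$ are given and only the bit is random, then $\mathbb E[P'^{(t)}]=P(m^{(t)}=1)P_G'^{(t)}+P(m^{(t)}=0)P_R'^{(t)}$.)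 Let $S$ be a segment of $N\ge 1$ consecutive tokens, numbered $t=1,\dots,N$, such that the events "the $t$-th token of $S$ is a required token" are mutually independent. Let $X$ be the number of required tokens in $S$, let $T=X/N$, and put $$\mu=\sum_{t=1}^N\mathbb E[P'^{(t)}],\qquad \sigma^2=\sum_{t=1}^N\mathbb E[P'^{(t)}]-\sum_{t=1}^N\mathbb E[P'^{(t)}]^2 .$$ **Claim.** 1. The $t$-th token is required with probability $\mathbb E[P'^{(t)}]$, and $X$ has the Poisson binomial distribution with parameters $\mathbb E[P'^{(1)}],\dots,\mathbb E[P'^{(N)}]$: for every integer $k\ge 0$, $$P(X=k)=\sum_{A\subseteq\{1,\dots,N\},\,|A|=k}\ \prod_{t\in A}\mathbb E[P'^{(t)}]\prod_{t\notin A}\bigl(1-\mathbb E[P'^{(t)}]\bigr).$$ Moreover $T$ is square-integrable, with $\mathbb E(T)=\mu/N$ and $\mathrm{Var}(T)=\sigma^2/N^2$. 2. $T$ is approximately $\mathcal N(\mu/N,\sigma^2/N^2)$-distributed when $\sigma^2$ is large: for every $\varepsilon>0$ there is a $B>0$, depending only on $\varepsilon$, such that for all texts and segments as above with $\sigma^2\ge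 B$, $$\sup_{x\in\mathbb R}\left|P(T\le x)-\mathcal N\!\left(\frac{\mu}{N},\frac{\sigma^2}{N^2}\right)\bigl((-\infty,x]\bigr)\right|\le\varepsilon .$$ -/

import Mathlib

open MeasureTheory ProbabilityTheory

universe u v

namespace Watermark

noncomputable section

/-- Softmax: the probability of token `i` when the logits are `l`. -/
def softmax {V : Type v} [Fintype V] (l : V → ℝ) (i : V) : ℝ :=
  Real.exp (l i) / ∑ j, Real.exp (l j)

/-- The list of tokens required to embed the bit `m`: the green list `G` if `m = 1`,
the red list (its complement) if `m = 0`. -/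
def requiredList {V : Type v} [Fintype V] [DecidableEq V] (G : Finset V) (m : Bool) : Finset V :=
  if m then G else Gᶜ

/-- Logits modification: the bias `δ` is added to the logits of the tokens of the required list. -/
def biasedLogits {V : Type v} [Fintype V] [DecidableEq V] (δ : ℝ) (G : Finset V) (m : Bool)
    (l : V → ℝ) (i : V) : ℝ :=
  if i ∈ requiredList G m then l i + δ else l i

/-- The probability, after watermarking, that the next token belongs to the list required for the
bit `m`. For `m = 1` this is the watermarked probability of the green list, for `m = 0` that of the
red list. -/
def watermarkedListProb {V : Type v} [Fintype V] [DecidableEq V] (δ : ℝ) (G : Finset V) (m : Bool)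
    (l : V → ℝ) : ℝ :=
  ∑ i ∈ requiredList G m, softmax (biasedLogits δ G m l) i

/-- A random text generated token by token by a language model with watermarking.
The logits are a function of the whole input (the prompt followed by the tokens generated so far).
At step `t` the bit to be embedded is `bit t`, the green list is `green t`, and, given these and
the tokens generated before, the token `token t` is drawn from the softmax of the biased logits. -/
structure WatermarkedText (V : Type v) [Fintype V] [DecidableEq V]
    {Ω : Type u} [MeasurableSpace Ω] (μ : Measure Ω) where
  /-- the language model -/
  logits : List V → V → ℝ
  /-- the prefix prompt -/
  prompt : List V
  /-- the watermark strength -/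
  δ : ℝ
  /-- the bit being embedded at each step -/
  bit : ℕ → Ω → Bool
  /-- the green list at each step -/
  green : ℕ → Ω → Finset V
  /-- the generated tokens -/
  token : ℕ → Ω → V
  measurableSet_bit : ∀ t b, MeasurableSet {ω | bit t ω = b}
  measurableSet_green : ∀ t G, MeasurableSet {ω | green t ω = G}
  measurableSet_token : ∀ t i, MeasurableSet {ω | token t ω = i}
  sampling : ∀ (t : ℕ) (s : List V) (G : Finset V) (b : Bool) (i : V),
    μ.real {ω | (List.range t).map (fun r => token r ω) = s ∧ green t ω = G ∧ bit t ω = b ∧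
        token t ω = i} =
      μ.real {ω | (List.range t).map (fun r => token r ω) = s ∧ green t ω = G ∧ bit t ω = b} *
        softmax (biasedLogits δ G b (logits (prompt ++ s))) i

namespace WatermarkedText

variable {V : Type v} [Fintype V] [DecidableEq V] {Ω : Type u} [MeasurableSpace Ω] {μ : Measure Ω}

/-- The logits at step `t`. -/
def stepLogits (W : WatermarkedText V μ) (t : ℕ) (ω : Ω) : V → ℝ :=
  W.logits (W.prompt ++ (List.range t).map (fun r => W.token r ω))

/-- The random probability `P'^(t)` that the next token at step `t` is one that is currently
required for embedding the watermark. -/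
def requiredProb (W : WatermarkedText V μ) (t : ℕ) (ω : Ω) : ℝ :=
  watermarkedListProb W.δ (W.green t ω) (W.bit t ω) (W.stepLogits t ω)

/-- The expectation `E[P'^(t)]`. -/
def expRequiredProb (W : WatermarkedText V μ) (t : ℕ) : ℝ :=
  ∫ ω, W.requiredProb t ω ∂μ

/-- The event that the token at step `t` is a required one. -/
def requiredEvent (W : WatermarkedText V μ) (t : ℕ) : Set Ω :=
  {ω | W.token t ω ∈ requiredList (W.green t ω) (W.bit t ω)}

open Classical in
/-- The number `X` of required tokens in the segment of the `N` tokens at steps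
`a, a + 1, …, a + N - 1`. -/
def requiredCount (W : WatermarkedText V μ) (a N : ℕ) (ω : Ω) : ℕ :=
  (Finset.univ.filter (fun i : Fin N => ω ∈ W.requiredEvent (a + i))).card

/-- The ratio `T = X / N` of required tokens in that segment. -/
def requiredFraction (W : WatermarkedText V μ) (a N : ℕ) (ω : Ω) : ℝ :=
  (W.requiredCount a N ω : ℝ) / N

/-- The sum over the segment of the expectations `E[P'^(t)]`. -/
def sumExp (W : WatermarkedText V μ) (a N : ℕ) : ℝ :=
  ∑ i : Fin N, W.expRequiredProb (a + i)

/-- The sum over the segment of the squared expectations `E[P'^(t)] ^ 2`. -/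
def sumExpSq (W : WatermarkedText V μ) (a N : ℕ) : ℝ :=
  ∑ i : Fin N, W.expRequiredProb (a + i) ^ 2

/-- When the logits and the green list at step `t` are given, so that only the bit is random,
`E[P'^(t)] = P(m = 1) P'_G + P(m = 0) P'_R`. -/
theorem expRequiredProb_eq [IsProbabilityMeasure μ] (W : WatermarkedText V μ) (t : ℕ)
    (l : V → ℝ) (G : Finset V) (hl : ∀ ω, W.stepLogits t ω = l) (hG : ∀ ω, W.green t ω = G) :
    W.expRequiredProb t =
      μ.real {ω | W.bit t ω = true} * watermarkedListProb W.δ G true l +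
        μ.real {ω | W.bit t ω = false} * watermarkedListProb W.δ G false l := by
  have h : ∀ ω, W.requiredProb t ω =
      {ω | W.bit t ω = true}.indicator (fun _ => watermarkedListProb W.δ G true l) ω +
      {ω | W.bit t ω = false}.indicator (fun _ => watermarkedListProb W.δ G false l) ω := by
    intro ω
    cases hb : W.bit t ω <;> simp [requiredProb, hl, hG, hb]
  unfold expRequiredProb
  simp_rw [h]
  rw [integral_add, integral_indicator_const _ (W.measurableSet_bit t true),
    integral_indicator_const _ (W.measurableSet_bit t false), smul_eq_mul, smul_eq_mul]
  · exact (integrable_const _).indicator (W.measurableSet_bit t true)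
  · exact (integrable_const _).indicator (W.measurableSet_bit t false)

end WatermarkedText

/-- The Poisson binomial probability of the value `k`: the probability of exactly `k` successes in
`N` independent trials with success probabilities `p 0, …, p (N - 1)`. -/
def poissonBinomial {N : ℕ} (p : Fin N → ℝ) (k : ℕ) : ℝ :=
  ∑ A ∈ Finset.univ.powersetCard k, (∏ i ∈ A, p i) * ∏ i ∈ Aᶜ, (1 - p i)

end

end Watermark

/-!
The token at step `t` is drawn from the biased softmax given the earlier tokens, the green list and
the bit, so, given these, it is required with probability `P'^(t)`; averaging over their finitely
many values shows that it is required with probability `E[P'^(t)]`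
(`WatermarkedText.measureReal_requiredEvent`). The rest concerns independent events `E i` of
probabilities `p i`. Summing the probability that exactly the events indexed by `A` occur over the
sets `A` of cardinality `k` gives the Poisson binomial law, and the mean and the variance of the
number of events that occur are the sums of those of the indicators.

Approximate normality is a central limit theorem for triangular arrays with a uniform threshold. Let
`σ ^ 2 = ∑ p i (1 - p i)`. For `|t| ≤ σ` the characteristic function of the standardized count is
within `|t| ^ 3 / σ + t ^ 4 / σ ^ 2` of `exp (- t ^ 2 / 2)`
(`norm_prod_centeredBernoulliCharFun_sub_gaussian_le`): both are products of factors of norm at most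
`1`, and corresponding factors agree to second order, with an error proportional to `p i (1 - p i)`.
Only `σ` enters this bound. Hence, by Lévy's convergence theorem, any sequence of such standardized
counts with `σ → ∞` converges weakly to the standard normal law, and by Pólya's theorem
(`eventually_forall_abs_cdf_sub_le`) its distribution functions converge uniformly. If no threshold
worked for some `ε`, a sequence of counterexamples would contradict this
(`exists_forall_abs_cdf_sub_gaussian_le`); the laws of the counts are measures on `ℝ`, whatever the
underlying probability spaces, so they do form one sequence.
-/

namespace Watermark

open Filter Topology

/-! ### Characteristic functions of sums of Bernoulli variables -/

lemma norm_prod_sub_prod_le {ι : Type*} (s : Finset ι) {f g : ι → ℂ}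
    (hf : ∀ i ∈ s, ‖f i‖ ≤ 1) (hg : ∀ i ∈ s, ‖g i‖ ≤ 1) :
    ‖∏ i ∈ s, f i - ∏ i ∈ s, g i‖ ≤ ∑ i ∈ s, ‖f i - g i‖ := by
  classical
  induction s using Finset.induction_on with
  | empty => simp
  | insert a s ha ih =>
    rw [Finset.prod_insert ha, Finset.prod_insert ha, Finset.sum_insert ha]
    have hs := ih (fun i hi => hf i (Finset.mem_insert_of_mem hi))
      (fun i hi => hg i (Finset.mem_insert_of_mem hi))
    have hg1 : ‖∏ i ∈ s, g i‖ ≤ 1 := by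
      rw [norm_prod]
      exact Finset.prod_le_one (fun _ _ => norm_nonneg _)
        (fun i hi => hg i (Finset.mem_insert_of_mem hi))
    have hfa := hf a (Finset.mem_insert_self a s)
    calc ‖f a * ∏ i ∈ s, f i - g a * ∏ i ∈ s, g i‖
        = ‖(f a - g a) * ∏ i ∈ s, g i + f a * (∏ i ∈ s, f i - ∏ i ∈ s, g i)‖ := by
          congr 1; ring
      _ ≤ ‖f a - g a‖ * ‖∏ i ∈ s, g i‖ + ‖f a‖ * ‖∏ i ∈ s, f i - ∏ i ∈ s, g i‖ := by
          refine (norm_add_le _ _).trans ?_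
          rw [norm_mul, norm_mul]
      _ ≤ ‖f a - g a‖ * 1 + 1 * ∑ i ∈ s, ‖f i - g i‖ := by gcongr
      _ = _ := by ring

/-- The characteristic function at `s` of the centered Bernoulli law, which has mass `p` at `1 - p`
and mass `1 - p` at `-p`. -/
noncomputable def centeredBernoulliCharFun (p s : ℝ) : ℂ :=
  p * Complex.exp ((s * (1 - p) : ℝ) * Complex.I) +
    (1 - p) * Complex.exp ((s * (-p) : ℝ) * Complex.I)

lemma norm_centeredBernoulliCharFun_le {p : ℝ} (hp0 : 0 ≤ p) (hp1 : p ≤ 1) (s : ℝ) :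
    ‖centeredBernoulliCharFun p s‖ ≤ 1 := by
  refine (norm_add_le _ _).trans ?_
  have h : ‖(1 - p : ℂ)‖ = 1 - p := by
    rw [← Complex.ofReal_one, ← Complex.ofReal_sub, Complex.norm_real, Real.norm_of_nonneg]
    linarith
  rw [norm_mul, norm_mul, Complex.norm_exp_ofReal_mul_I, Complex.norm_exp_ofReal_mul_I, h,
    Complex.norm_real, Real.norm_of_nonneg hp0]
  linarith

lemma norm_exp_mul_I_sub_taylor_le {x : ℝ} (hx : |x| ≤ 1) :
    ‖Complex.exp (x * Complex.I) - (1 + x * Complex.I - x ^ 2 / 2)‖ ≤ |x| ^ 3 := by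
  have hn : ‖(x * Complex.I : ℂ)‖ = |x| := by simp
  have h := Complex.exp_bound (x := x * Complex.I) (by rwa [hn]) (n := 3) (by norm_num)
  rw [hn] at h
  have e : ∑ m ∈ Finset.range 3, (x * Complex.I : ℂ) ^ m / m.factorial
      = 1 + x * Complex.I - x ^ 2 / 2 := by
    simp [Finset.sum_range_succ, mul_pow, Nat.factorial]
    ring
  rw [e] at h
  refine h.trans ?_
  have : 0 ≤ |x| ^ 3 := by positivity
  norm_num [Nat.factorial]
  linarith

/-- A centered Bernoulli variable and a centered normal variable with the same variance
`q = p (1 - p)` have the same second-order expansion `1 - s ^ 2 q / 2` of the characteristic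
function. The error keeps the factor `q`, so that the errors of many factors add up to a multiple of
the total variance. -/
lemma norm_centeredBernoulliCharFun_sub_gaussian_le {p s : ℝ} (hp0 : 0 ≤ p) (hp1 : p ≤ 1)
    (hs : |s| ≤ 1) :
    ‖centeredBernoulliCharFun p s - Complex.exp (-(s ^ 2 * (p * (1 - p)) / 2) : ℝ)‖
      ≤ p * (1 - p) * (|s| ^ 3 + s ^ 4) := by
  have hq : 0 ≤ 1 - p := by linarith
  have hqle : p * (1 - p) ≤ 1 := by nlinarith
  have hs2 : s ^ 2 ≤ 1 := by rw [← sq_abs]; exact pow_le_one₀ (abs_nonneg s) hs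
  have b1 : |s * (1 - p)| ≤ |s| * (1 - p) := by rw [abs_mul, abs_of_nonneg hq]
  have b2 : |s * (-p)| ≤ |s| * p := by rw [abs_mul, abs_neg, abs_of_nonneg hp0]
  have h1 := norm_exp_mul_I_sub_taylor_le (x := s * (1 - p))
    (b1.trans (mul_le_one₀ hs hq (by linarith)))
  have h2 := norm_exp_mul_I_sub_taylor_le (x := s * (-p)) (b2.trans (mul_le_one₀ hs hp0 hp1))
  have h1' := h1.trans (pow_le_pow_left₀ (abs_nonneg _) b1 3)
  have h2' := h2.trans (pow_le_pow_left₀ (abs_nonneg _) b2 3)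
  set q : ℝ := p * (1 - p) with hqdef
  have hq0 : 0 ≤ q := mul_nonneg hp0 hq
  have h3 : |Real.exp (-(s ^ 2 * q / 2)) - 1 - (-(s ^ 2 * q / 2))| ≤ (-(s ^ 2 * q / 2)) ^ 2 := by
    apply Real.abs_exp_sub_one_sub_id_le
    rw [abs_neg, abs_of_nonneg (by positivity)]
    nlinarith [mul_le_one₀ hs2 hq0 hqle]
  have h3' : ‖Complex.exp (-(s ^ 2 * q / 2) : ℝ) - (1 - s ^ 2 * q / 2)‖
      ≤ (-(s ^ 2 * q / 2)) ^ 2 := by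
    rw [← Complex.ofReal_exp]
    refine le_trans (le_of_eq ?_) h3
    rw [← Real.norm_eq_abs, ← Complex.norm_real]
    congr 1
    push_cast
    ring
  have key : centeredBernoulliCharFun p s - Complex.exp (-(s ^ 2 * q / 2) : ℝ)
      = p * (Complex.exp ((s * (1 - p) : ℝ) * Complex.I) -
          (1 + (s * (1 - p) : ℝ) * Complex.I - ((s * (1 - p) : ℝ) : ℂ) ^ 2 / 2))
        + (1 - p : ℝ) * (Complex.exp ((s * (-p) : ℝ) * Complex.I) -
          (1 + (s * (-p) : ℝ) * Complex.I - ((s * (-p) : ℝ) : ℂ) ^ 2 / 2))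
        - (Complex.exp (-(s ^ 2 * q / 2) : ℝ) - (1 - s ^ 2 * q / 2)) := by
    rw [centeredBernoulliCharFun, hqdef]
    push_cast
    ring
  rw [key]
  refine (norm_sub_le _ _).trans ((add_le_add_left (norm_add_le _ _) _).trans ?_)
  rw [norm_mul, norm_mul, Complex.norm_real, Complex.norm_real, Real.norm_of_nonneg hp0,
    Real.norm_of_nonneg hq]
  calc _ ≤ p * (|s| * (1 - p)) ^ 3 + (1 - p) * (|s| * p) ^ 3 + (-(s ^ 2 * q / 2)) ^ 2 := by
        gcongr
    _ = q * (|s| ^ 3 * ((1 - p) ^ 2 + p ^ 2) + s ^ 4 * (q / 4)) := by rw [hqdef]; ring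
    _ ≤ q * (|s| ^ 3 * 1 + s ^ 4 * 1) := by
        gcongr
        · nlinarith
        · linarith
    _ = _ := by ring

/-- The characteristic function of a standardized sum of independent Bernoulli variables of total
variance `σ ^ 2` is close to that of the standard normal law, with a bound in which the success
probabilities enter only through `σ`. -/
lemma norm_prod_centeredBernoulliCharFun_sub_gaussian_le {ι : Type*} [Fintype ι] {p : ι → ℝ}
    (hp0 : ∀ i, 0 ≤ p i) (hp1 : ∀ i, p i ≤ 1) {σ : ℝ} (hσ : 0 < σ)
    (hvar : ∑ i, p i * (1 - p i) = σ ^ 2) {t : ℝ} (ht : |t| ≤ σ) :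
    ‖∏ i, centeredBernoulliCharFun (p i) (t / σ) - Complex.exp (-(t ^ 2 / 2) : ℝ)‖
      ≤ |t| ^ 3 / σ + t ^ 4 / σ ^ 2 := by
  have hs : |t / σ| ≤ 1 := by rw [abs_div, abs_of_pos hσ]; exact div_le_one_of_le₀ ht hσ.le
  have hexp : Complex.exp (-(t ^ 2 / 2) : ℝ)
      = ∏ i, Complex.exp (-((t / σ) ^ 2 * (p i * (1 - p i)) / 2) : ℝ) := by
    rw [← Complex.exp_sum, ← Complex.ofReal_sum, Finset.sum_neg_distrib, ← Finset.sum_div,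
      ← Finset.mul_sum, hvar]
    congr 3
    field_simp
  rw [hexp]
  refine (norm_prod_sub_prod_le _
    (fun i _ => norm_centeredBernoulliCharFun_le (hp0 i) (hp1 i) _) ?_).trans ?_
  · intro i _
    rw [← Complex.ofReal_exp, Complex.norm_real, Real.norm_of_nonneg (Real.exp_pos _).le,
      Real.exp_le_one_iff, neg_nonpos]
    have := mul_nonneg (hp0 i) (sub_nonneg.2 (hp1 i))
    positivity
  · refine (Finset.sum_le_sum fun i _ =>
      norm_centeredBernoulliCharFun_sub_gaussian_le (hp0 i) (hp1 i) hs).trans (le_of_eq ?_)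
    rw [← Finset.sum_mul, hvar, abs_div, abs_of_pos hσ]
    field_simp

/-! ### Uniform convergence of distribution functions -/

lemma continuous_cdf (ν : Measure ℝ) [IsProbabilityMeasure ν] [NullSingletonClass ν] :
    Continuous (cdf ν) := by
  refine continuous_iff_continuousAt.2 fun x => ?_
  rw [(monotone_cdf ν).continuousAt_iff_leftLim_eq_rightLim]
  have h : (cdf ν).measure {x} = 0 := by rw [measure_cdf]; exact measure_singleton x
  rw [StieltjesFunction.measure_singleton, ENNReal.ofReal_eq_zero] at h
  have h1 := (monotone_cdf ν).leftLim_le (le_refl x)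
  rw [StieltjesFunction.rightLim_eq]
  linarith

lemma exists_cdf_eq (ν : Measure ℝ) [IsProbabilityMeasure ν] [NullSingletonClass ν] {c : ℝ}
    (h0 : 0 < c) (h1 : c < 1) : ∃ y, cdf ν y = c := by
  obtain ⟨a, ha⟩ := ((tendsto_cdf_atBot ν).eventually (gt_mem_nhds h0)).exists
  obtain ⟨b, hb⟩ := ((tendsto_cdf_atTop ν).eventually (lt_mem_nhds h1)).exists
  exact mem_range_of_exists_le_of_exists_ge (continuous_cdf ν) ⟨a, ha.le⟩ ⟨b, hb.le⟩

lemma tendsto_cdf_of_tendsto {ν : ℕ → ProbabilityMeasure ℝ} {ν₀ : ProbabilityMeasure ℝ}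
    [NullSingletonClass (ν₀ : Measure ℝ)] (h : Tendsto ν atTop (𝓝 ν₀)) (y : ℝ) :
    Tendsto (fun n => cdf (ν n : Measure ℝ) y) atTop (𝓝 (cdf (ν₀ : Measure ℝ) y)) := by
  simp_rw [cdf_eq_real]
  refine (ENNReal.tendsto_toReal (measure_ne_top _ _)).comp
    (ProbabilityMeasure.tendsto_measure_of_null_frontier_of_tendsto' h ?_)
  rw [frontier_Iic]
  exact measure_singleton y

/-- **Pólya's theorem**: if probability measures on `ℝ` converge weakly to one without atoms, their
distribution functions converge uniformly. By monotonicity, closeness at the quantiles of the levels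
`k / m` of the limit gives closeness everywhere, up to `3 / m`. -/
lemma eventually_forall_abs_cdf_sub_le {ν : ℕ → ProbabilityMeasure ℝ} {ν₀ : ProbabilityMeasure ℝ}
    [NullSingletonClass (ν₀ : Measure ℝ)] (h : Tendsto ν atTop (𝓝 ν₀)) {ε : ℝ} (hε : 0 < ε) :
    ∀ᶠ n in atTop, ∀ x, |cdf (ν n : Measure ℝ) x - cdf (ν₀ : Measure ℝ) x| ≤ ε := by
  obtain ⟨m, hm⟩ := exists_nat_gt (3 / ε)
  have hm0 : (0 : ℝ) < m := lt_trans (by positivity) hm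
  have hmε : 3 / (m : ℝ) ≤ ε := by
    rw [div_lt_iff₀ hε] at hm
    rw [div_le_iff₀ hm0]
    linarith
  -- the quantiles of the levels `k / m`; the indices `0` and `m` need none
  have hy : ∀ k : ℕ, ∃ y, 0 < k → k < m → cdf (ν₀ : Measure ℝ) y = k / m := by
    intro k
    by_cases hk : 0 < k ∧ k < m
    · obtain ⟨y, hy⟩ := exists_cdf_eq (ν₀ : Measure ℝ) (c := k / m)
        (div_pos (by exact_mod_cast hk.1) hm0)
        ((div_lt_one hm0).2 (by exact_mod_cast hk.2))
      exact ⟨y, fun _ _ => hy⟩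
    · exact ⟨0, fun h1 h2 => absurd ⟨h1, h2⟩ hk⟩
  choose y hy using hy
  have hev : ∀ᶠ n in atTop, ∀ k ∈ Finset.range m,
      |cdf (ν n : Measure ℝ) (y k) - cdf (ν₀ : Measure ℝ) (y k)| < 1 / m := by
    rw [eventually_all_finset]
    intro k _
    exact (tendsto_cdf_of_tendsto h (y k)).eventually (Metric.ball_mem_nhds _ (by positivity))
  filter_upwards [hev] with n hn x
  set F := cdf (ν₀ : Measure ℝ)
  set G := cdf (ν n : Measure ℝ)
  have hF0 : 0 ≤ F x := cdf_nonneg _ x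
  have hG0 : 0 ≤ G x := cdf_nonneg _ x
  have hG1 : G x ≤ 1 := cdf_le_one _ x
  -- `F x` lies in the cell `[k / m, (k + 1) / m)` of the grid
  obtain ⟨k, hk1, hk2⟩ : ∃ k : ℕ, (k : ℝ) / m ≤ F x ∧ F x < (k + 1) / m := by
    refine ⟨⌊F x * m⌋₊, ?_, ?_⟩
    · rw [div_le_iff₀ hm0]; exact Nat.floor_le (by positivity)
    · rw [lt_div_iff₀ hm0]; exact Nat.lt_floor_add_one _
  have hadd : ∀ a b : ℝ, (a + b) / m = a / m + b / m := fun a b => add_div a b _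
  have h3 : (3 : ℝ) / m = 1 / m + 1 / m + 1 / m := by ring
  have hup : G x ≤ (k + 1) / m + 1 / m := by
    by_cases hkm : k + 1 < m
    · have e := hy (k + 1) (Nat.succ_pos k) hkm
      push_cast at e
      have hxy : x ≤ y (k + 1) := by
        by_contra! hlt
        have := monotone_cdf (ν₀ : Measure ℝ) hlt.le
        linarith
      have := (abs_lt.1 (hn (k + 1) (Finset.mem_range.2 hkm))).2
      have := monotone_cdf (ν n : Measure ℝ) hxy
      linarith
    · have : (1 : ℝ) ≤ (k + 1) / m := by
        rw [le_div_iff₀ hm0, one_mul]; exact_mod_cast not_lt.1 hkm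
      have : 0 < 1 / (m : ℝ) := by positivity
      linarith
  have hlow : ((k : ℝ) - 1) / m - 1 / m ≤ G x := by
    by_cases hk : 2 ≤ k
    · obtain ⟨j, rfl⟩ : ∃ j, k = j + 1 := ⟨k - 1, by omega⟩
      have hFx1 : F x ≤ 1 := cdf_le_one _ x
      have hjm : j < m := by
        have : ((j + 1 : ℕ) : ℝ) ≤ m := by
          rw [div_le_iff₀ hm0] at hk1; nlinarith
        exact_mod_cast this
      have e := hy j (by omega) hjm
      push_cast at hk1 ⊢
      have hxy : y j ≤ x := by
        by_contra! hlt
        have := monotone_cdf (ν₀ : Measure ℝ) hlt.le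
        have : 0 < 1 / (m : ℝ) := by positivity
        have := hadd j 1
        linarith
      have := (abs_lt.1 (hn j (Finset.mem_range.2 hjm))).1
      have := monotone_cdf (ν n : Measure ℝ) hxy
      rw [add_sub_cancel_right]
      linarith
    · have hk' : (k : ℝ) ≤ 1 := by exact_mod_cast (by omega : k ≤ 1)
      have : ((k : ℝ) - 1) / m ≤ 0 := div_nonpos_of_nonpos_of_nonneg (by linarith) hm0.le
      have : 0 < 1 / (m : ℝ) := by positivity
      linarith
  have e1 := hadd k 1
  have e2 : ((k : ℝ) - 1) / m = k / m - 1 / m := by ring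
  rw [abs_le]
  constructor <;> linarith

/-- The bound on characteristic functions of `norm_prod_centeredBernoulliCharFun_sub_gaussian_le`
makes the distribution function uniformly close to the standard normal one when `σ` is large. The
threshold does not depend on `ν`: measures violating the claim for larger and larger `σ` would form
a sequence that converges weakly to the normal law, by Lévy's theorem. -/
lemma exists_forall_abs_cdf_sub_gaussian_le {ε : ℝ} (hε : 0 < ε) :
    ∃ b : ℝ, 0 < b ∧ ∀ (ν : Measure ℝ) [IsProbabilityMeasure ν] (σ : ℝ), b ≤ σ →
      (∀ t : ℝ, |t| ≤ σ →
        ‖charFun ν t - Complex.exp (-(t ^ 2 / 2) : ℝ)‖ ≤ |t| ^ 3 / σ + t ^ 4 / σ ^ 2) →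
      ∀ x, |cdf ν x - cdf (gaussianReal 0 1) x| ≤ ε := by
  by_contra! hcon
  choose! ν hν σ hσ hchar x hx using fun n : ℕ => hcon (n + 1) (by positivity)
  let νp : ℕ → ProbabilityMeasure ℝ := fun n => ⟨ν n, hν n⟩
  let γ : ProbabilityMeasure ℝ := ⟨gaussianReal 0 1, inferInstance⟩
  have hσtop : Tendsto σ atTop atTop :=
    tendsto_atTop_mono (fun n => (by linarith [hσ n] : (n : ℝ) ≤ σ n)) tendsto_natCast_atTop_atTop
  have hlim : Tendsto νp atTop (𝓝 γ) := by
    refine ProbabilityMeasure.tendsto_iff_tendsto_charFun.2 fun t => ?_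
    change Tendsto (fun n => charFun (ν n) t) atTop (𝓝 (charFun (gaussianReal 0 1) t))
    have e : charFun (gaussianReal 0 1) t = Complex.exp (-(t ^ 2 / 2) : ℝ) := by
      rw [charFun_gaussianReal]; push_cast; congr 1; simp
    rw [e, tendsto_iff_norm_sub_tendsto_zero]
    have hb : Tendsto (fun n => |t| ^ 3 / σ n + t ^ 4 / σ n ^ 2) atTop (𝓝 0) := by
      simpa using (hσtop.const_div_atTop (|t| ^ 3)).add
        (((tendsto_pow_atTop two_ne_zero).comp hσtop).const_div_atTop (t ^ 4))
    refine squeeze_zero' (.of_forall fun _ => norm_nonneg _) ?_ hb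
    filter_upwards [hσtop.eventually_ge_atTop |t|] with n hn using hchar n t hn
  have : NullSingletonClass (γ : Measure ℝ) := nullSingletonClass_gaussianReal one_ne_zero
  obtain ⟨n, hn⟩ := (eventually_forall_abs_cdf_sub_le hlim hε).exists
  exact absurd (hn (x n)) (not_le.2 (hx n))

/-! ### Independent events -/

section IndependentEvents

open Classical in
lemma natCast_card_filter_mem {Ω : Type*} {N : ℕ} {E : Fin N → Set Ω} (ω : Ω) :
    ((Finset.univ.filter (fun i => ω ∈ E i)).card : ℝ)
      = ∑ i, (E i).indicator (fun _ => (1 : ℝ)) ω := by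
  simp [Set.indicator_apply]

variable {Ω : Type*} [MeasurableSpace Ω] {μ : Measure Ω} {N : ℕ} {E : Fin N → Set Ω}

open Classical in
/-- Exactly the events indexed by `A` occur with the product probability, as independence of events
carries over to their complements. -/
lemma measureReal_setOf_filter_mem_eq (hE : iIndepSet E μ) (hm : ∀ i, MeasurableSet (E i))
    (A : Finset (Fin N)) :
    μ.real {ω | Finset.univ.filter (fun i => ω ∈ E i) = A}
      = (∏ i ∈ A, μ.real (E i)) * ∏ i ∈ Aᶜ, (1 - μ.real (E i)) := by
  have := hE.isProbabilityMeasure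
  have hset : {ω | Finset.univ.filter (fun i => ω ∈ E i) = A}
      = ⋂ i, if i ∈ A then E i else (E i)ᶜ := by
    ext ω
    simp only [Set.mem_ofPred_eq, Finset.ext_iff, Finset.mem_filter, Finset.mem_univ, true_and,
      Set.mem_iInter]
    refine forall_congr' fun i => ?_
    by_cases hi : i ∈ A <;> simp [hi]
  have hgen : ∀ i, MeasurableSet[MeasurableSpace.generateFrom {E i}]
      (if i ∈ A then E i else (E i)ᶜ) := by
    intro i
    have h1 := MeasurableSpace.measurableSet_generateFrom (Set.mem_singleton (E i))
    split_ifs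
    · exact h1
    · exact h1.compl
  rw [hset, measureReal_def, ((iIndepSet_iff_iIndep E μ).1 hE).meas_iInter hgen, ENNReal.toReal_prod,
    ← Finset.prod_mul_prod_compl A]
  congr 1
  · exact Finset.prod_congr rfl fun i hi => by rw [if_pos hi, measureReal_def]
  · refine Finset.prod_congr rfl fun i hi => ?_
    rw [if_neg (Finset.mem_compl.1 hi), ← measureReal_def, probReal_compl_eq_one_sub (hm i)]

open Classical in
lemma measureReal_setOf_card_filter_mem_eq (hE : iIndepSet E μ) (hm : ∀ i, MeasurableSet (E i))
    (k : ℕ) :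
    μ.real {ω | (Finset.univ.filter (fun i => ω ∈ E i)).card = k}
      = poissonBinomial (fun i => μ.real (E i)) k := by
  have := hE.isProbabilityMeasure
  have hmeas : ∀ A : Finset (Fin N),
      MeasurableSet {ω | Finset.univ.filter (fun i => ω ∈ E i) = A} := by
    intro A
    have : {ω | Finset.univ.filter (fun i => ω ∈ E i) = A} = ⋂ i, {ω | ω ∈ E i ↔ i ∈ A} := by
      ext ω; simp [Finset.ext_iff]
    rw [this]
    refine MeasurableSet.iInter fun i => ?_
    by_cases hi : i ∈ A
    · simpa [hi] using hm i
    · simp only [hi, iff_false]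
      exact (hm i).compl
  have hset : {ω | (Finset.univ.filter (fun i => ω ∈ E i)).card = k}
      = ⋃ A ∈ Finset.univ.powersetCard k, {ω | Finset.univ.filter (fun i => ω ∈ E i) = A} := by
    ext ω
    simp
  rw [hset, measureReal_biUnion_finset _ fun A _ => hmeas A]
  · exact Finset.sum_congr rfl fun A _ => measureReal_setOf_filter_mem_eq hE hm A
  · intro A _ B _ hAB
    exact Set.disjoint_left.2 fun ω hA hB => hAB (hA.symm.trans hB)

lemma memLp_indicator_one [IsProbabilityMeasure μ] {s : Set Ω} (hs : MeasurableSet s) :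
    MemLp (s.indicator fun _ => (1 : ℝ)) 2 μ :=
  memLp_indicator_const 2 hs 1 (Or.inr (measure_ne_top μ s))

lemma variance_indicator_one [IsProbabilityMeasure μ] {s : Set Ω} (hs : MeasurableSet s) :
    variance (s.indicator fun _ => (1 : ℝ)) μ = μ.real s - μ.real s ^ 2 := by
  have h2 : (s.indicator fun _ => (1 : ℝ)) ^ 2 = s.indicator fun _ => (1 : ℝ) := by
    ext ω
    by_cases h : ω ∈ s <;> simp [h]
  rw [variance_eq_sub (memLp_indicator_one hs), h2, integral_indicator_const _ hs]
  simp

lemma variance_sum_indicator_one (hE : iIndepSet E μ) (hm : ∀ i, MeasurableSet (E i)) :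
    variance (fun ω => ∑ i, (E i).indicator (fun _ => (1 : ℝ)) ω) μ
      = ∑ i, (μ.real (E i) - μ.real (E i) ^ 2) := by
  have := hE.isProbabilityMeasure
  have hind : iIndepFun (fun i => (E i).indicator fun _ => (1 : ℝ)) μ := hE.iIndepFun_indicator
  have h := IndepFun.variance_sum (s := Finset.univ)
    (X := fun i => (E i).indicator fun _ => (1 : ℝ)) (μ := μ)
    (fun i _ => memLp_indicator_one (hm i)) fun i _ j _ hij => hind.indepFun hij
  rw [Finset.sum_fn] at h
  rw [h]
  exact Finset.sum_congr rfl fun i _ => variance_indicator_one (hm i)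

lemma charFun_map_centered_indicator [IsProbabilityMeasure μ] {s : Set Ω} (hs : MeasurableSet s)
    (σ t : ℝ) :
    charFun (μ.map fun ω => (s.indicator (fun _ => (1 : ℝ)) ω - μ.real s) / σ) t
      = centeredBernoulliCharFun (μ.real s) (t / σ) := by
  have hmeas : Measurable fun ω => (s.indicator (fun _ => (1 : ℝ)) ω - μ.real s) / σ :=
    ((measurable_const.indicator hs).sub_const _).div_const _
  rw [charFun_apply_real, integral_map hmeas.aemeasurable (by fun_prop)]
  have h : ∀ ω, Complex.exp
      (t * ((s.indicator (fun _ => (1 : ℝ)) ω - μ.real s) / σ : ℝ) * Complex.I)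
      = s.indicator (fun _ => Complex.exp ((t / σ * (1 - μ.real s) : ℝ) * Complex.I)) ω
        + sᶜ.indicator (fun _ => Complex.exp ((t / σ * (-μ.real s) : ℝ) * Complex.I)) ω := by
    intro ω
    by_cases hω : ω ∈ s
    · simp only [hω, Set.indicator_of_mem, Set.mem_compl_iff, not_true_eq_false,
        not_false_eq_true, Set.indicator_of_notMem, add_zero]
      congr 2; push_cast; ring
    · simp only [hω, Set.indicator_of_mem, Set.mem_compl_iff,
        not_false_eq_true, Set.indicator_of_notMem, zero_add, zero_sub]
      congr 2; push_cast; ring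
  simp_rw [h]
  rw [integral_add ((integrable_const _).indicator hs) ((integrable_const _).indicator hs.compl),
    integral_indicator_const _ hs, integral_indicator_const _ hs.compl,
    probReal_compl_eq_one_sub hs, centeredBernoulliCharFun]
  simp

lemma charFun_map_standardized_sum (hE : iIndepSet E μ) (hm : ∀ i, MeasurableSet (E i))
    (σ t : ℝ) :
    charFun (μ.map fun ω => ∑ i, ((E i).indicator (fun _ => (1 : ℝ)) ω - μ.real (E i)) / σ) t
      = ∏ i, centeredBernoulliCharFun (μ.real (E i)) (t / σ) := by
  have := hE.isProbabilityMeasure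
  have hmeas : ∀ i, Measurable fun ω =>
      ((E i).indicator (fun _ => (1 : ℝ)) ω - μ.real (E i)) / σ :=
    fun i => ((measurable_const.indicator (hm i)).sub_const _).div_const _
  have hind : iIndepFun
      (fun i ω => ((E i).indicator (fun _ => (1 : ℝ)) ω - μ.real (E i)) / σ) μ :=
    (hE.iIndepFun_indicator (β := ℝ)).comp (fun i x => (x - μ.real (E i)) / σ)
      fun i => by fun_prop
  rw [hind.charFun_map_fun_sum_eq_prod fun i => (hmeas i).aemeasurable, Finset.prod_apply]
  exact Finset.prod_congr rfl fun i _ => charFun_map_centered_indicator (hm i) σ t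

lemma gaussianReal_real_Iic_eq_cdf_standard (m : ℝ) {s : ℝ} (hs : 0 < s) (x : ℝ) :
    (gaussianReal m (s ^ 2).toNNReal).real (Set.Iic x)
      = cdf (gaussianReal 0 1) ((x - m) / s) := by
  have h : gaussianReal m (s ^ 2).toNNReal = (gaussianReal 0 1).map fun y => s * y + m := by
    have e := Measure.map_map (μ := gaussianReal 0 1) (g := fun y : ℝ => y + m)
      (f := fun y => s * y) (by fun_prop) (by fun_prop)
    rw [gaussianReal_map_const_mul, gaussianReal_map_add_const] at e
    refine Eq.trans ?_ e
    congr 1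
    · simp
    · ext; simp [sq_nonneg]
  rw [h, cdf_eq_real, map_measureReal_apply (by fun_prop) measurableSet_Iic]
  congr 1
  ext y
  simp only [Set.mem_preimage, Set.mem_Iic]
  rw [le_div_iff₀ hs]
  constructor <;> intro <;> linarith

open Classical in
/-- The central limit theorem for independent events, uniformly over all families of events: the
fraction of the events that occur has a distribution function within `ε` of that of the normal law
with the same mean and variance, as soon as the variance of the number of events that occur is at
least a bound that depends only on `ε`. -/
lemma exists_forall_abs_card_filter_mem_sub_gaussian_le {ε : ℝ} (hε : 0 < ε) :
    ∃ B : ℝ, 0 < B ∧ ∀ {Ω : Type u} [MeasurableSpace Ω] (μ : Measure Ω) (N : ℕ)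
      (E : Fin N → Set Ω), 0 < N → iIndepSet E μ → (∀ i, MeasurableSet (E i)) →
      B ≤ ∑ i, (μ.real (E i) - μ.real (E i) ^ 2) → ∀ x : ℝ,
      |μ.real {ω | ((Finset.univ.filter (fun i => ω ∈ E i)).card : ℝ) / N ≤ x}
        - (gaussianReal ((∑ i, μ.real (E i)) / N)
            ((∑ i, (μ.real (E i) - μ.real (E i) ^ 2)) / (N : ℝ) ^ 2).toNNReal).real (Set.Iic x)|
        ≤ ε := by
  -- `b` bounds the standard deviation from below, so the variance is to be at least `b ^ 2`
  obtain ⟨b, hb, H⟩ := exists_forall_abs_cdf_sub_gaussian_le hε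
  refine ⟨b ^ 2, by positivity, fun {Ω} _ μ N E hN hE hm hB x => ?_⟩
  have := hE.isProbabilityMeasure
  have hN' : (0 : ℝ) < N := by exact_mod_cast hN
  set v := ∑ i, (μ.real (E i) - μ.real (E i) ^ 2) with hv
  set m := ∑ i, μ.real (E i) with hmdef
  have hv0 : 0 < v := lt_of_lt_of_le (by positivity) hB
  set σ := √v
  have hσ : 0 < σ := Real.sqrt_pos.2 hv0
  have hσ2 : σ ^ 2 = v := Real.sq_sqrt hv0.le
  have hbσ : b ≤ σ := Real.le_sqrt_of_sq_le hB
  have hmeas : Measurable fun ω =>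
      ∑ i, ((E i).indicator (fun _ => (1 : ℝ)) ω - μ.real (E i)) / σ :=
    Finset.measurable_fun_sum _ fun i _ =>
      ((measurable_const.indicator (hm i)).sub_const _).div_const _
  have hprob := Measure.isProbabilityMeasure_map (μ := μ) hmeas.aemeasurable
  have key := H (μ.map _) σ hbσ (fun t ht => by
    rw [charFun_map_standardized_sum hE hm σ t]
    refine norm_prod_centeredBernoulliCharFun_sub_gaussian_le (fun i => measureReal_nonneg)
      (fun i => measureReal_le_one) hσ ?_ ht
    rw [hσ2, hv]
    exact Finset.sum_congr rfl fun i _ => by ring) ((N * x - m) / σ)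
  rw [cdf_eq_real, map_measureReal_apply hmeas measurableSet_Iic] at key
  have hset : (fun ω => ∑ i, ((E i).indicator (fun _ => (1 : ℝ)) ω - μ.real (E i)) / σ) ⁻¹'
      Set.Iic ((N * x - m) / σ)
      = {ω | ((Finset.univ.filter (fun i => ω ∈ E i)).card : ℝ) / N ≤ x} := by
    ext ω
    rw [Set.mem_preimage, Set.mem_Iic, Set.mem_ofPred_eq, natCast_card_filter_mem,
      ← Finset.sum_div, Finset.sum_sub_distrib, div_le_div_iff_of_pos_right hσ,
      sub_le_sub_iff_right, div_le_iff₀' hN']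
  rw [hset] at key
  have hvar : v / (N : ℝ) ^ 2 = (σ / N) ^ 2 := by rw [div_pow, hσ2]
  rw [hvar, gaussianReal_real_Iic_eq_cdf_standard _ (div_pos hσ hN')]
  convert key using 4
  field_simp

end IndependentEvents

/-! ### The probability that a token is a required one -/

namespace WatermarkedText

variable {V : Type v} [Fintype V] [DecidableEq V] {Ω : Type u} [MeasurableSpace Ω] {μ : Measure Ω}

lemma measurableSet_requiredEvent (W : WatermarkedText V μ) (t : ℕ) :
    MeasurableSet (W.requiredEvent t) := by
  have h : W.requiredEvent t = ⋃ (i : V) (G : Finset V) (b : Bool) (_ : i ∈ requiredList G b),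
      {ω | W.token t ω = i} ∩ {ω | W.green t ω = G} ∩ {ω | W.bit t ω = b} := by
    ext ω
    simp only [requiredEvent, Set.mem_ofPred_eq, Set.mem_iUnion, Set.mem_inter_iff]
    constructor
    · intro h
      exact ⟨_, _, _, h, ⟨rfl, rfl⟩, rfl⟩
    · rintro ⟨i, G, b, h, ⟨rfl, rfl⟩, rfl⟩
      exact h
  rw [h]
  exact MeasurableSet.iUnion fun i => .iUnion fun G => .iUnion fun b => .iUnion fun _ =>
    ((W.measurableSet_token t i).inter (W.measurableSet_green t G)).inter
      (W.measurableSet_bit t b)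

/-- The data that determine the distribution of the token at step `t`: the earlier tokens, the green
list and the bit. The earlier tokens are encoded as a function on `Fin t` rather than as a list, so
that `stepData` takes values in a finite type. -/
def stepData (W : WatermarkedText V μ) (t : ℕ) (ω : Ω) : (Fin t → V) × Finset V × Bool :=
  (fun r => W.token r ω, W.green t ω, W.bit t ω)

lemma map_range_token (W : WatermarkedText V μ) (t : ℕ) (ω : Ω) :
    (List.range t).map (fun r => W.token r ω) = List.ofFn fun r : Fin t => W.token r ω := by
  rw [List.ofFn_eq_map, ← List.map_coe_finRange_eq_range, List.map_map]
  rfl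

/-- The events `stepData t = (s, G, b)` are those on which `WatermarkedText.sampling` conditions. -/
lemma setOf_stepData_eq (W : WatermarkedText V μ) (t : ℕ) (s : Fin t → V) (G : Finset V)
    (b : Bool) :
    {ω | W.stepData t ω = (s, G, b)}
      = {ω | (List.range t).map (fun r => W.token r ω) = List.ofFn s ∧ W.green t ω = G ∧
          W.bit t ω = b} := by
  ext ω
  simp only [stepData, Set.mem_ofPred_eq, Prod.mk.injEq, map_range_token, List.ofFn_inj]

lemma measurableSet_stepData_eq (W : WatermarkedText V μ) (t : ℕ)
    (h : (Fin t → V) × Finset V × Bool) : MeasurableSet {ω | W.stepData t ω = h} := by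
  obtain ⟨s, G, b⟩ := h
  have : {ω | W.stepData t ω = (s, G, b)}
      = (⋂ r : Fin t, {ω | W.token r ω = s r}) ∩ {ω | W.green t ω = G} ∩ {ω | W.bit t ω = b} := by
    ext ω
    simp [stepData, funext_iff, and_assoc]
  rw [this]
  exact ((MeasurableSet.iInter fun r : Fin t => W.measurableSet_token r (s r)).inter
    (W.measurableSet_green t G)).inter (W.measurableSet_bit t b)

/-- Given the data of step `t`, the token is required with the probability that the biased softmax
gives to the required list. -/
lemma measureReal_stepData_eq_inter_requiredEvent [IsProbabilityMeasure μ]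
    (W : WatermarkedText V μ) (t : ℕ) (s : Fin t → V) (G : Finset V) (b : Bool) :
    μ.real ({ω | W.stepData t ω = (s, G, b)} ∩ W.requiredEvent t)
      = μ.real {ω | W.stepData t ω = (s, G, b)} *
        watermarkedListProb W.δ G b (W.logits (W.prompt ++ List.ofFn s)) := by
  have hset : {ω | W.stepData t ω = (s, G, b)} ∩ W.requiredEvent t
      = ⋃ i ∈ requiredList G b, {ω | W.stepData t ω = (s, G, b)} ∩ {ω | W.token t ω = i} := by
    ext ω
    simp only [Set.mem_inter_iff, Set.mem_ofPred_eq, requiredEvent, Set.mem_iUnion, exists_prop]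
    constructor
    · rintro ⟨h, h2⟩
      simp only [stepData, Prod.mk.injEq] at h
      exact ⟨_, by rwa [h.2.1, h.2.2] at h2, by simp [stepData, h], rfl⟩
    · rintro ⟨i, hi, h, rfl⟩
      refine ⟨h, ?_⟩
      simp only [stepData, Prod.mk.injEq] at h
      rwa [h.2.1, h.2.2]
  rw [hset, measureReal_biUnion_finset _ fun i _ =>
    (W.measurableSet_stepData_eq t _).inter (W.measurableSet_token t i), watermarkedListProb,
    Finset.mul_sum]
  · refine Finset.sum_congr rfl fun i _ => ?_
    rw [setOf_stepData_eq, ← W.sampling]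
    congr 1
    ext ω
    simp [and_assoc]
  · intro i _ j _ hij
    exact Set.disjoint_left.2 fun ω hi hj => hij (hi.2.symm.trans hj.2)

/-- The token at step `t` is required with probability `E[P'^(t)]`: the law of total probability
over the finitely many values of `stepData`, on each of which `P'^(t)` is constant. -/
lemma measureReal_requiredEvent [IsProbabilityMeasure μ] (W : WatermarkedText V μ) (t : ℕ) :
    μ.real (W.requiredEvent t) = W.expRequiredProb t := by
  set P : (Fin t → V) × Finset V × Bool → ℝ := fun h =>
    watermarkedListProb W.δ h.2.1 h.2.2 (W.logits (W.prompt ++ List.ofFn h.1)) with hP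
  have hfun : ∀ ω, W.requiredProb t ω
      = ∑ h, {ω | W.stepData t ω = h}.indicator (fun _ => P h) ω := by
    intro ω
    rw [Finset.sum_eq_single (W.stepData t ω)]
    · simp [hP, requiredProb, stepLogits, stepData, map_range_token]
    · intro h _ hne
      exact Set.indicator_of_notMem (fun h' => hne h'.symm) _
    · simp
  unfold expRequiredProb
  simp_rw [hfun]
  rw [integral_finsetSum _ fun h _ =>
    (integrable_const _).indicator (W.measurableSet_stepData_eq t h)]
  have hunion : W.requiredEvent t
      = ⋃ h ∈ Finset.univ, {ω | W.stepData t ω = h} ∩ W.requiredEvent t := by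
    ext ω
    simp
  rw [hunion, measureReal_biUnion_finset _ fun h _ =>
    (W.measurableSet_stepData_eq t h).inter (W.measurableSet_requiredEvent t)]
  · refine Finset.sum_congr rfl fun h _ => ?_
    obtain ⟨s, G, b⟩ := h
    rw [integral_indicator_const _ (W.measurableSet_stepData_eq t _), smul_eq_mul,
      measureReal_stepData_eq_inter_requiredEvent]
  · intro h _ h' _ hne
    exact Set.disjoint_left.2 fun ω hi hj => hne (hi.1.symm.trans hj.1)

end WatermarkedText

end Watermark

/-! ### Law, moments and approximate normality of the fraction of required tokens -/

theorem lemma2 :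
    -- exact law of `X`, exact mean and variance of `T`
    (∀ (V : Type v) [Fintype V] [DecidableEq V] (Ω : Type u) [MeasurableSpace Ω]
        (μ : Measure Ω) [IsProbabilityMeasure μ] (W : Watermark.WatermarkedText V μ)
        (a N : ℕ), 0 < N →
        iIndepSet (fun i : Fin N => W.requiredEvent (a + i)) μ →
        (∀ i : Fin N, μ.real (W.requiredEvent (a + i)) = W.expRequiredProb (a + i)) ∧
        (∀ k : ℕ, μ.real {ω | W.requiredCount a N ω = k} =
          Watermark.poissonBinomial (fun i : Fin N => W.expRequiredProb (a + i)) k) ∧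
        MemLp (W.requiredFraction a N) 2 μ ∧
        ∫ ω, W.requiredFraction a N ω ∂μ = W.sumExp a N / N ∧
        variance (W.requiredFraction a N) μ = (W.sumExp a N - W.sumExpSq a N) / (N : ℝ) ^ 2) ∧
    -- approximate normality of `T`, uniformly over all texts and segments
    (∀ ε : ℝ, 0 < ε → ∃ B : ℝ, 0 < B ∧
      ∀ (V : Type v) [Fintype V] [DecidableEq V] (Ω : Type u) [MeasurableSpace Ω]
        (μ : Measure Ω) [IsProbabilityMeasure μ] (W : Watermark.WatermarkedText V μ)
        (a N : ℕ), 0 < N →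
        iIndepSet (fun i : Fin N => W.requiredEvent (a + i)) μ →
        B ≤ W.sumExp a N - W.sumExpSq a N →
        ∀ x : ℝ,
          |μ.real {ω | W.requiredFraction a N ω ≤ x} -
            (gaussianReal (W.sumExp a N / N)
              ((W.sumExp a N - W.sumExpSq a N) / (N : ℝ) ^ 2).toNNReal).real (Set.Iic x)| ≤ ε) := by
  refine ⟨?_, fun ε hε => ?_⟩
  · intro V _ _ Ω _ μ _ W a N _ hind
    have hm := fun i : Fin N => W.measurableSet_requiredEvent (a + i)
    have hfrac : W.requiredFraction a N = fun ω =>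
        (∑ i : Fin N, (W.requiredEvent (a + i)).indicator (fun _ => (1 : ℝ)) ω) / N := by
      ext ω
      rw [Watermark.WatermarkedText.requiredFraction, Watermark.WatermarkedText.requiredCount,
        Watermark.natCast_card_filter_mem]
    refine ⟨fun i => W.measureReal_requiredEvent _, fun k => ?_, ?_, ?_, ?_⟩
    · simp_rw [← W.measureReal_requiredEvent]
      exact Watermark.measureReal_setOf_card_filter_mem_eq hind hm k
    · simp_rw [hfrac, div_eq_mul_inv]
      exact (memLp_finsetSum _ fun i _ => Watermark.memLp_indicator_one (hm i)).mul_const _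
    · simp_rw [hfrac]
      rw [integral_div, integral_finsetSum _ fun i _ => (integrable_const _).indicator (hm i),
        Watermark.WatermarkedText.sumExp]
      congr 1
      refine Finset.sum_congr rfl fun i _ => ?_
      rw [integral_indicator_const _ (hm i), W.measureReal_requiredEvent, smul_eq_mul, mul_one]
    · simp_rw [hfrac, div_eq_mul_inv]
      rw [variance_mul_const, Watermark.variance_sum_indicator_one hind hm,
        Finset.sum_sub_distrib]
      simp_rw [W.measureReal_requiredEvent]
      rw [Watermark.WatermarkedText.sumExp, Watermark.WatermarkedText.sumExpSq, inv_pow]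
  · obtain ⟨B, hB, H⟩ :=
      Watermark.exists_forall_abs_card_filter_mem_sub_gaussian_le.{u} hε
    refine ⟨B, hB, fun V _ _ Ω _ μ _ W a N hN hind hBW x => ?_⟩
    have h := H μ N _ hN hind (fun i => W.measurableSet_requiredEvent (a + i))
    simp_rw [W.measureReal_requiredEvent, Finset.sum_sub_distrib] at h
    exact h hBW x
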